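/- Let $A\in\mathbb R^{n_x\times n_x}$, $B\in\mathbb R^{n_x\times n_u}$, $Q\in\mathbb R^{n_x\times n_x}$, $R\in\mathbb R^{n_u\times n_u}$, $S\in\mathbb R^{n_u\times n_x}$ with $\begin{bmatrix}Q&S^\top\\ S&R\end{bmatrix}\succ0$, and let $(w_t)_{t\ge0}$ be square-integrable random vectors in $\mathbb R^{n_x}$ with $\mathbb E w_t=0$, $\mathbb E w_tw_t^\top=I$ and $\mathbb E w_sw_t^\top=0$ for $s\ne t$ (for example i.i.d.). Consider $x_{t+1}=Ax_t+Bu_t+w_t$, $x_0=0$, with the average cost $$C=\lim_{T\to\infty}\frac1T\,\mathbb E\sum_{t=0}^{T-1}\left(x_t^\top Qx_t+u_t^\top Ru_t+2u_t^\top Sx_t\right).$$ Write $C(K)$ for the cost of the state feedback $u_t=Kx_t$, and $C(L^{(H)})$ for the cost of the $H$-order disturbance response controller (DRC) $u_t=L^{(H)}_1w_{t-1}+\dots+L^{(H)}_Hw_{t-H}$, where $w_s=0$ for $s<0$. Let $K_\star=-(R+B^\top PB)^{-1}(B^\top PA+S)$ be the optimal LQR gain, where $P\succeq0$ solves the Riccati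 equation $P=A^\top PA-(A^\top PB+S^\top)(R+B^\top PB)^{-1}(B^\top PA+S)+Q$. Let $\|\cdot\|$ be the matrix $\ell_2$ (spectral) norm, and suppose that for some $\tau\in\mathbb R$ and $\rho>0$ both $A$ and $A+BK_\star$ are $(\tau,e^{-\rho})$-stable, that is, $\|A^k\|\le\tau e^{-\rho k}$ and $\|(A+BK_\star)^k\|\le\tau e^{-\rho k}$ for all integers $k\ge0$. Then the limit defining $C(K_\star)$ exists. For every $H\ge0$ the limit defining $C(L^{(H)})$ exists for every $H$-order DRC, a minimizer of $C$ over the $H$-order DRCs exists, and every minimizer $L_\star^{(H)}$ satisfies $$0\le C(L_\star^{(H)})-C(K_\star)\le n_x^2e^{-2\rho H}\left(\|R\|+\frac{4\tau^4\left(\|B\|\|K_\star\|^2+\|K_\star\|\right)\left(\|B\|\|Q\|+\|S\|\right)}{(1-e^{-2\rho})^3}\right).$$ In particular, the optimal $H$-order DRC cost approaches the optimal LQR cost exponentially fast in $H$. -/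

import Mathlib

open scoped Matrix.Norms.L2Operator

/-- `M` is `(τ, γ)`-stable: `‖M ^ k‖ ≤ τ γ ^ k` for all `k`, in the spectral (ℓ²-operator) norm. -/
def IsTauStable {n : ℕ} (τ γ : ℝ) (M : Matrix (Fin n) (Fin n) ℝ) : Prop :=
  ∀ k : ℕ, ‖M ^ k‖ ≤ τ * γ ^ k

/-- Second-order white noise: square integrable, zero mean, identity covariance, uncorrelated
in time. In particular i.i.d. sequences of zero mean and identity covariance qualify. -/
structure IsStandardNoise {Ω : Type*} [MeasurableSpace Ω] (μ : MeasureTheory.Measure Ω) {n : ℕ}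
    (w : ℕ → Ω → Fin n → ℝ) : Prop where
  memLp : ∀ t i, MeasureTheory.MemLp (fun ω => w t ω i) 2 μ
  mean : ∀ t i, ∫ ω, w t ω i ∂μ = 0
  cov : ∀ s t i j, ∫ ω, w s ω i * w t ω j ∂μ = if s = t ∧ i = j then 1 else 0

/-- The data of a linear quadratic regulator problem with `n` states and `m` inputs. -/
structure LQRSystem (n m : ℕ) where
  A : Matrix (Fin n) (Fin n) ℝ
  B : Matrix (Fin n) (Fin m) ℝ
  Q : Matrix (Fin n) (Fin n) ℝ
  R : Matrix (Fin m) (Fin m) ℝ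
  S : Matrix (Fin m) (Fin n) ℝ

namespace LQRSystem

open Matrix

variable {n m : ℕ}

/-- The weight `[[Q, Sᵀ], [S, R]]` of the quadratic stage cost. -/
def weight (sys : LQRSystem n m) : Matrix (Fin n ⊕ Fin m) (Fin n ⊕ Fin m) ℝ :=
  Matrix.fromBlocks sys.Q sys.Sᵀ sys.S sys.R

/-- The stage cost `xᵀ Q x + uᵀ R u + 2 uᵀ S x`. -/
def stageCost (sys : LQRSystem n m) (x : Fin n → ℝ) (u : Fin m → ℝ) : ℝ :=
  x ⬝ᵥ (sys.Q *ᵥ x) + u ⬝ᵥ (sys.R *ᵥ u) + 2 * (u ⬝ᵥ (sys.S *ᵥ x))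

/-- The trajectory `x 0 = 0`, `x (t + 1) = A x t + B u t + w t` under an input sequence `u`. -/
def state (sys : LQRSystem n m) (u : ℕ → Fin m → ℝ) (w : ℕ → Fin n → ℝ) : ℕ → Fin n → ℝ
  | 0 => 0
  | t + 1 => sys.A *ᵥ sys.state u w t + sys.B *ᵥ u t + w t

/-- The closed-loop trajectory under state feedback `u t = K x t`, started at `x 0 = 0`. -/
def feedbackState (sys : LQRSystem n m) (K : Matrix (Fin m) (Fin n) ℝ) (w : ℕ → Fin n → ℝ) :
    ℕ → Fin n → ℝ
  | 0 => 0
  | t + 1 => sys.A *ᵥ sys.feedbackState K w t + sys.B *ᵥ (K *ᵥ sys.feedbackState K w t) + w t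

/-- The input `u t = L₁ w (t - 1) + ⋯ + L_H w (t - H)` of an `H`-order disturbance response
controller, with `w s = 0` for `s < 0`. The entry `L h`, for `h : Fin H`, is `L_{h + 1}`. -/
def drcInput {H : ℕ} (L : Fin H → Matrix (Fin m) (Fin n) ℝ) (w : ℕ → Fin n → ℝ) (t : ℕ) :
    Fin m → ℝ :=
  ∑ h : Fin H, if (h : ℕ) + 1 ≤ t then L h *ᵥ w (t - ((h : ℕ) + 1)) else 0

variable {Ω : Type*} [MeasurableSpace Ω]

/-- The expected average cost over the first `T` steps under state feedback `K`. -/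
noncomputable def feedbackAvgCost (sys : LQRSystem n m) (μ : MeasureTheory.Measure Ω)
    (w : ℕ → Ω → Fin n → ℝ) (K : Matrix (Fin m) (Fin n) ℝ) (T : ℕ) : ℝ :=
  (1 / (T : ℝ)) * ∫ ω, ∑ t ∈ Finset.range T,
    sys.stageCost (sys.feedbackState K (fun s => w s ω) t)
      (K *ᵥ sys.feedbackState K (fun s => w s ω) t) ∂μ

/-- The expected average cost over the first `T` steps under the controller `L`. -/
noncomputable def drcAvgCost (sys : LQRSystem n m) (μ : MeasureTheory.Measure Ω)
    (w : ℕ → Ω → Fin n → ℝ) {H : ℕ} (L : Fin H → Matrix (Fin m) (Fin n) ℝ) (T : ℕ) : ℝ :=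
  (1 / (T : ℝ)) * ∫ ω, ∑ t ∈ Finset.range T,
    sys.stageCost (sys.state (drcInput L (fun s => w s ω)) (fun s => w s ω) t)
      (drcInput L (fun s => w s ω) t) ∂μ

/-- The infinite-horizon average cost `C(K)`. -/
noncomputable def feedbackCost (sys : LQRSystem n m) (μ : MeasureTheory.Measure Ω)
    (w : ℕ → Ω → Fin n → ℝ) (K : Matrix (Fin m) (Fin n) ℝ) : ℝ :=
  Filter.limUnder Filter.atTop (sys.feedbackAvgCost μ w K)

/-- The infinite-horizon average cost `C(L)`. -/
noncomputable def drcCost (sys : LQRSystem n m) (μ : MeasureTheory.Measure Ω)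
    (w : ℕ → Ω → Fin n → ℝ) {H : ℕ} (L : Fin H → Matrix (Fin m) (Fin n) ℝ) : ℝ :=
  Filter.limUnder Filter.atTop (sys.drcAvgCost μ w L)

/-- `L` minimizes the infinite-horizon average cost over all controllers of its order. -/
def IsOptimalDRC (sys : LQRSystem n m) (μ : MeasureTheory.Measure Ω)
    (w : ℕ → Ω → Fin n → ℝ) {H : ℕ} (L : Fin H → Matrix (Fin m) (Fin n) ℝ) : Prop :=
  ∀ L' : Fin H → Matrix (Fin m) (Fin n) ℝ, sys.drcCost μ w L ≤ sys.drcCost μ w L'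

/-- `P` is a positive semidefinite solution of the discrete algebraic Riccati equation
`P = Aᵀ P A - (Aᵀ P B + Sᵀ) (R + Bᵀ P B)⁻¹ (Bᵀ P A + S) + Q`. -/
def IsCostToGo (sys : LQRSystem n m) (P : Matrix (Fin n) (Fin n) ℝ) : Prop :=
  P.PosSemidef ∧
    P = sys.Aᵀ * P * sys.A
      - (sys.Aᵀ * P * sys.B + sys.Sᵀ) * (sys.R + sys.Bᵀ * P * sys.B)⁻¹
        * (sys.Bᵀ * P * sys.A + sys.S) + sys.Q

/-- The LQR gain `-(R + Bᵀ P B)⁻¹ (Bᵀ P A + S)` attached to `P`. -/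
noncomputable def gain (sys : LQRSystem n m) (P : Matrix (Fin n) (Fin n) ℝ) :
    Matrix (Fin m) (Fin n) ℝ :=
  -((sys.R + sys.Bᵀ * P * sys.B)⁻¹ * (sys.Bᵀ * P * sys.A + sys.S))

end LQRSystem

/-!
Under standardized white noise, an input that filters past disturbances linearly has average cost
`∑ i, cost (X i) (U i)`, where `U` and `X` are the input and state responses to a unit impulse.
Completing the square through the Riccati equation turns this sum into
`tr P + ∑ i, tr ((U i - K X i)ᵀ (R + Bᵀ P B) (U i - K X i))`. Hence the feedback `K` costs `tr P`,
no controller costs less, and the cost controls the size of a finite response, which is compactness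
enough for a minimizer. For the upper bound, take the first `H` responses of the feedback `K`
itself: the two costs then differ only in the tails `A ^ k (A + B K) ^ H` and `(A + B K) ^ (k + H)`,
which both decay like `exp (-ρ (k + H))`.
-/

section TraceForm

open Matrix

variable {ι κ ν : Type*} [Fintype ι] [Fintype κ] [Fintype ν]

/-- The Frobenius pairing `tr (Xᵀ W Y)` weighted by `W`. It is the expectation of
`(X w)ᵀ W (Y w)` for a random vector `w` with identity second moments. -/
def traceForm (W : Matrix ι κ ℝ) (X : Matrix ι ν ℝ) (Y : Matrix κ ν ℝ) : ℝ :=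
  (Xᵀ * W * Y).trace

theorem traceForm_comm (W : Matrix ι κ ℝ) (X : Matrix ι ν ℝ) (Y : Matrix κ ν ℝ) :
    traceForm W X Y = traceForm Wᵀ Y X := by
  rw [traceForm, traceForm, ← trace_transpose]
  simp only [transpose_mul, transpose_transpose, Matrix.mul_assoc]

theorem traceForm_eq_sum_dotProduct (W : Matrix ι κ ℝ) (X : Matrix ι ν ℝ) (Y : Matrix κ ν ℝ) :
    traceForm W X Y = ∑ j, Xᵀ j ⬝ᵥ (W *ᵥ Yᵀ j) := by
  refine Finset.sum_congr rfl fun j _ => ?_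
  rw [Matrix.mul_assoc, diag_apply, mul_apply]
  rfl

theorem traceForm_self_nonneg {W : Matrix ι ι ℝ} (hW : W.PosSemidef) (X : Matrix ι ν ℝ) :
    0 ≤ traceForm W X X :=
  (hW.conjTranspose_mul_mul_same X).trace_nonneg

theorem traceForm_self_pos {W : Matrix ι ι ℝ} (hW : W.PosDef) {X : Matrix ι ν ℝ} (hX : X ≠ 0) :
    0 < traceForm W X X := by
  obtain ⟨j, hj⟩ : ∃ j, Xᵀ j ≠ 0 :=
    Function.ne_iff.1 fun h => hX (transpose_eq_zero.1 h)
  rw [traceForm_eq_sum_dotProduct]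
  exact Finset.sum_pos' (fun i _ => hW.posSemidef.dotProduct_mulVec_nonneg (Xᵀ i))
    ⟨j, Finset.mem_univ j, hW.dotProduct_mulVec_pos hj⟩

theorem traceForm_smul_smul (W : Matrix ι κ ℝ) (c : ℝ) (X : Matrix ι ν ℝ) (Y : Matrix κ ν ℝ) :
    traceForm W (c • X) (c • Y) = c ^ 2 * traceForm W X Y := by
  simp only [traceForm, transpose_smul, Matrix.smul_mul, Matrix.mul_smul, trace_smul, smul_eq_mul]
  ring

theorem continuous_traceForm {α : Type*} [TopologicalSpace α] (W : Matrix ι κ ℝ)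
    {X : α → Matrix ι ν ℝ} {Y : α → Matrix κ ν ℝ} (hX : Continuous X) (hY : Continuous Y) :
    Continuous fun a => traceForm W (X a) (Y a) :=
  ((hX.matrix_transpose.matrix_mul continuous_const).matrix_mul hY).matrix_trace

variable [DecidableEq κ] [DecidableEq ν]

theorem l2_opNorm_transpose [DecidableEq ι] (X : Matrix ι κ ℝ) : ‖Xᵀ‖ = ‖X‖ := by
  rw [← conjTranspose_eq_transpose_of_trivial, l2_opNorm_conjTranspose]

theorem abs_apply_le_l2_opNorm (X : Matrix ι κ ℝ) (i : ι) (j : κ) : |X i j| ≤ ‖X‖ := by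
  have hcol := l2_opNorm_mulVec X (EuclideanSpace.single j (1 : ℝ))
  rw [PiLp.norm_single, norm_one, mul_one] at hcol
  calc |X i j| = ‖WithLp.toLp 2 (X *ᵥ EuclideanSpace.single j (1 : ℝ)) i‖ := by
        simp [Real.norm_eq_abs]
    _ ≤ ‖X‖ := (PiLp.norm_apply_le _ i).trans hcol

theorem trace_le_card_mul_l2_opNorm (X : Matrix ν ν ℝ) : X.trace ≤ Fintype.card ν * ‖X‖ :=
  calc X.trace ≤ ∑ _i : ν, ‖X‖ :=
        Finset.sum_le_sum fun i _ => (le_abs_self _).trans (abs_apply_le_l2_opNorm X i i)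
    _ = Fintype.card ν * ‖X‖ := by simp

theorem l2_opNorm_transpose_mul_mul_le (W : Matrix ι κ ℝ) (X : Matrix ι ν ℝ) (Y : Matrix κ ν ℝ) :
    ‖Xᵀ * W * Y‖ ≤ ‖X‖ * ‖W‖ * ‖Y‖ := by
  classical
  calc ‖Xᵀ * W * Y‖ ≤ ‖Xᵀ‖ * ‖W‖ * ‖Y‖ :=
        (l2_opNorm_mul _ _).trans (by gcongr; exact l2_opNorm_mul _ _)
    _ = ‖X‖ * ‖W‖ * ‖Y‖ := by rw [l2_opNorm_transpose]

theorem traceForm_le (W : Matrix ι κ ℝ) (X : Matrix ι ν ℝ) (Y : Matrix κ ν ℝ) :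
    traceForm W X Y ≤ Fintype.card ν * (‖X‖ * ‖W‖ * ‖Y‖) :=
  (trace_le_card_mul_l2_opNorm _).trans (by gcongr; exact l2_opNorm_transpose_mul_mul_le W X Y)

end TraceForm

theorem exists_pos_mul_norm_sq_le {E : Type*} [NormedAddCommGroup E] [NormedSpace ℝ E]
    [ProperSpace E] {f : E → ℝ} (hcont : Continuous f) (hpos : ∀ x ≠ 0, 0 < f x)
    (hsmul : ∀ (c : ℝ) x, f (c • x) = c ^ 2 * f x) : ∃ ε > 0, ∀ x, ε * ‖x‖ ^ 2 ≤ f x := by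
  have hzero : f 0 = 0 := by simpa using hsmul 0 0
  rcases subsingleton_or_nontrivial E with _ | _
  · exact ⟨1, one_pos, fun x => by simp [Subsingleton.elim x 0, hzero]⟩
  obtain ⟨z, hz, hmin⟩ := (isCompact_sphere (0 : E) 1).exists_isMinOn
    (NormedSpace.sphere_nonempty.2 zero_le_one) hcont.continuousOn
  refine ⟨f z, hpos z (ne_zero_of_mem_unit_sphere ⟨z, hz⟩), fun x => ?_⟩
  rcases eq_or_ne x 0 with rfl | hx
  · simp [hzero]
  have hnorm : 0 < ‖x‖ := norm_pos_iff.2 hx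
  have hunit : f z ≤ f (‖x‖⁻¹ • x) := hmin (by simp [norm_smul, hnorm.ne'])
  calc f z * ‖x‖ ^ 2 ≤ f (‖x‖⁻¹ • x) * ‖x‖ ^ 2 := by gcongr
    _ = f x := by rw [hsmul]; field_simp

theorem exists_pos_mul_norm_sq_le_traceForm {ι ν : Type*} [Fintype ι] [Fintype ν] [DecidableEq ν]
    {W : Matrix ι ι ℝ} (hW : W.PosDef) :
    ∃ ε > 0, ∀ X : Matrix ι ν ℝ, ε * ‖X‖ ^ 2 ≤ traceForm W X X :=
  exists_pos_mul_norm_sq_le (continuous_traceForm W continuous_id continuous_id)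
    (fun _ => traceForm_self_pos hW) fun c X => traceForm_smul_smul W c X X

theorem hasSum_sub_succ {f : ℕ → ℝ} (hf : Summable f) :
    HasSum (fun i => f i - f (i + 1)) (f 0) := by
  simpa using hf.hasSum.sub ((hasSum_nat_add_iff' 1).2 hf.hasSum)

open Matrix in
/-- The Gramian `∑ k, (M ^ k)ᵀ W M ^ k`: the cost-to-go of the weight `W` along `x (t + 1) = M x t`.
It is `0` by convention when the series diverges. -/
noncomputable def gramian {ι : Type*} [Fintype ι] [DecidableEq ι] (M W : Matrix ι ι ℝ) :
    Matrix ι ι ℝ :=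
  ∑' k : ℕ, (M ^ k)ᵀ * W * M ^ k

namespace IsTauStable

open Matrix

variable {n : ℕ} {τ r : ℝ} {M N : Matrix (Fin n) (Fin n) ℝ}

theorem nonneg (hM : IsTauStable τ r M) : 0 ≤ τ := by
  simpa using (norm_nonneg _).trans (hM 0)

theorem norm_pow_mul_pow_le (hM : IsTauStable τ r M) (hN : IsTauStable τ r N) (hr : 0 ≤ r)
    (k H : ℕ) : ‖M ^ k * N ^ H‖ ≤ τ ^ 2 * r ^ (k + H) := by
  have hτ := hM.nonneg
  calc ‖M ^ k * N ^ H‖ ≤ ‖M ^ k‖ * ‖N ^ H‖ := norm_mul_le _ _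
    _ ≤ (τ * r ^ k) * (τ * r ^ H) := by gcongr; exacts [hM k, hN H]
    _ = τ ^ 2 * r ^ (k + H) := by ring

/-- The extra factor `r` on the left avoids `r ^ (k + H - 1)`. -/
theorem norm_pow_sub_pow_mul_pow_le (hM : IsTauStable τ r M) (hN : IsTauStable τ r N) (hr : 0 ≤ r)
    (k H : ℕ) : r * ‖(M ^ k - N ^ k) * N ^ H‖ ≤ k * (τ ^ 2 * ‖M - N‖ * r ^ (k + H)) := by
  have hτ := hM.nonneg
  induction k generalizing H with
  | zero => simp
  | succ k ih =>
    have hsplit : (M ^ (k + 1) - N ^ (k + 1)) * N ^ H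
        = M ^ k * (M - N) * N ^ H + (M ^ k - N ^ k) * N ^ (H + 1) := by
      rw [pow_succ M, pow_succ N, pow_succ' N H]
      noncomm_ring
    have hfirst : ‖M ^ k * (M - N) * N ^ H‖ ≤ (τ * r ^ k) * ‖M - N‖ * (τ * r ^ H) := by
      refine norm_mul₃_le.trans ?_
      gcongr
      exacts [hM k, hN H]
    calc r * ‖(M ^ (k + 1) - N ^ (k + 1)) * N ^ H‖
        ≤ r * ‖M ^ k * (M - N) * N ^ H‖ + r * ‖(M ^ k - N ^ k) * N ^ (H + 1)‖ := by
          rw [hsplit, ← mul_add]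
          gcongr
          exact norm_add_le _ _
      _ ≤ r * ((τ * r ^ k) * ‖M - N‖ * (τ * r ^ H))
          + k * (τ ^ 2 * ‖M - N‖ * r ^ (k + (H + 1))) :=
          add_le_add (mul_le_mul_of_nonneg_left hfirst hr) (ih (H + 1))
      _ = (k + 1 : ℕ) * (τ ^ 2 * ‖M - N‖ * r ^ (k + 1 + H)) := by push_cast; ring

theorem summable_transpose_mul_mul (hM : IsTauStable τ r M) (hr : 0 ≤ r) (hr1 : r < 1)
    (W : Matrix (Fin n) (Fin n) ℝ) : Summable fun k : ℕ => (M ^ k)ᵀ * W * M ^ k := by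
  have hτ := hM.nonneg
  have hgeom : Summable fun k : ℕ => τ ^ 2 * ‖W‖ * (r ^ 2) ^ k :=
    (summable_geometric_of_lt_one (by positivity) (by nlinarith)).mul_left _
  refine hgeom.of_norm_bounded fun k => (l2_opNorm_transpose_mul_mul_le _ _ _).trans ?_
  calc ‖M ^ k‖ * ‖W‖ * ‖M ^ k‖ ≤ (τ * r ^ k) * ‖W‖ * (τ * r ^ k) := by
        gcongr <;> exact hM k
    _ = τ ^ 2 * ‖W‖ * (r ^ 2) ^ k := by ring

theorem hasSum_traceForm (hM : IsTauStable τ r M) (hr : 0 ≤ r) (hr1 : r < 1) {ν : Type*}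
    [Fintype ν] (W : Matrix (Fin n) (Fin n) ℝ) (Y : Matrix (Fin n) ν ℝ) :
    HasSum (fun k : ℕ => traceForm W (M ^ k * Y) (M ^ k * Y)) (traceForm (gramian M W) Y Y) := by
  let evalAt : Matrix (Fin n) (Fin n) ℝ →+ ℝ := AddMonoidHom.mk' (fun Z => traceForm Z Y Y)
    fun Z Z' => by simp only [traceForm, Matrix.mul_add, Matrix.add_mul, trace_add]
  have hcont : Continuous evalAt :=
    ((continuous_const.matrix_mul continuous_id).matrix_mul continuous_const).matrix_trace
  refine ((hM.summable_transpose_mul_mul hr hr1 W).hasSum.map evalAt hcont).congr_fun fun k => ?_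
  simp only [Function.comp_apply, evalAt, AddMonoidHom.mk'_apply, traceForm, transpose_mul,
    Matrix.mul_assoc]

end IsTauStable

/-- Disturbances whose coordinates, over all times, are orthonormal in `L²(μ)`: second-order white
noise as seen by quadratic costs, which involve second moments only. -/
structure IsOrthonormalNoise {Ω : Type*} [MeasurableSpace Ω] (μ : MeasureTheory.Measure Ω)
    {ι : Type*} [DecidableEq ι] (w : ℕ → Ω → ι → ℝ) : Prop where
  memLp : ∀ t i, MeasureTheory.MemLp (fun ω => w t ω i) 2 μ
  cov : ∀ s t i j, ∫ ω, w s ω i * w t ω j ∂μ = if s = t ∧ i = j then 1 else 0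

theorem IsStandardNoise.isOrthonormalNoise {Ω : Type*} [MeasurableSpace Ω]
    {μ : MeasureTheory.Measure Ω} {n : ℕ} {w : ℕ → Ω → Fin n → ℝ} (hw : IsStandardNoise μ w) :
    IsOrthonormalNoise μ w :=
  ⟨hw.memLp, hw.cov⟩

section FilterResponse

open Matrix MeasureTheory

variable {ι α β : Type*} [Fintype ι]

/-- The response `F 0 w (t - 1) + ⋯ + F (t - 1) w 0` of a linear filter with impulse response `F`
to the signal `w`. -/
def filterResponse (F : ℕ → Matrix α ι ℝ) (w : ℕ → ι → ℝ) (t : ℕ) : α → ℝ :=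
  ∑ i ∈ Finset.range t, F i *ᵥ w (t - (i + 1))

theorem filterResponse_succ (F : ℕ → Matrix α ι ℝ) (w : ℕ → ι → ℝ) (t : ℕ) :
    filterResponse F w (t + 1) = filterResponse (fun i => F (i + 1)) w t + F 0 *ᵥ w t := by
  simp [filterResponse, Finset.sum_range_succ']

theorem filterResponse_add (F G : ℕ → Matrix α ι ℝ) (w : ℕ → ι → ℝ) (t : ℕ) :
    filterResponse (fun i => F i + G i) w t = filterResponse F w t + filterResponse G w t := by
  simp only [filterResponse, add_mulVec, Finset.sum_add_distrib]

variable [Fintype α]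

theorem mulVec_filterResponse (K : Matrix β α ℝ) (F : ℕ → Matrix α ι ℝ) (w : ℕ → ι → ℝ) (t : ℕ) :
    K *ᵥ filterResponse F w t = filterResponse (fun i => K * F i) w t := by
  simp only [filterResponse, mulVec_sum, mulVec_mulVec]

variable [Fintype β]

theorem filterResponse_dotProduct_mulVec (W : Matrix α β ℝ) (F : ℕ → Matrix α ι ℝ)
    (G : ℕ → Matrix β ι ℝ) (w : ℕ → ι → ℝ) (t : ℕ) :
    filterResponse F w t ⬝ᵥ (W *ᵥ filterResponse G w t)
      = ∑ i ∈ Finset.range t, ∑ j ∈ Finset.range t,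
        w (t - (i + 1)) ⬝ᵥ (((F i)ᵀ * W * G j) *ᵥ w (t - (j + 1))) := by
  rw [filterResponse, filterResponse, mulVec_sum, sum_dotProduct]
  refine Finset.sum_congr rfl fun i _ => ?_
  rw [dotProduct_sum]
  refine Finset.sum_congr rfl fun j _ => ?_
  rw [← mulVec_mulVec, ← mulVec_mulVec, dotProduct_mulVec (w _), vecMul_transpose]

theorem dotProduct_mulVec_eq_sum_sum (N : Matrix α β ℝ) (x : α → ℝ) (y : β → ℝ) :
    x ⬝ᵥ (N *ᵥ y) = ∑ i, ∑ j, N i j * (x i * y j) := by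
  simp only [dotProduct, mulVec, Finset.mul_sum]
  exact Finset.sum_congr rfl fun i _ => Finset.sum_congr rfl fun j _ => by ring

end FilterResponse

namespace IsOrthonormalNoise

open Matrix MeasureTheory

variable {Ω : Type*} [MeasurableSpace Ω] {μ : Measure Ω}
  {ι α β : Type*} [DecidableEq ι] {w : ℕ → Ω → ι → ℝ}

theorem integrable_const_mul_mul (hw : IsOrthonormalNoise μ w) (c : ℝ) (s t : ℕ) (i j : ι) :
    Integrable (fun ω => c * (w s ω i * w t ω j)) μ :=
  ((hw.memLp s i).integrable_mul (hw.memLp t j)).const_mul c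

variable [Fintype ι]

theorem integrable_dotProduct_mulVec (hw : IsOrthonormalNoise μ w) (N : Matrix ι ι ℝ) (s t : ℕ) :
    Integrable (fun ω => w s ω ⬝ᵥ (N *ᵥ w t ω)) μ := by
  simp only [dotProduct_mulVec_eq_sum_sum]
  exact integrable_finsetSum _ fun i _ => integrable_finsetSum _ fun j _ =>
    hw.integrable_const_mul_mul (N i j) s t i j

theorem integral_dotProduct_mulVec (hw : IsOrthonormalNoise μ w) (N : Matrix ι ι ℝ) (s t : ℕ) :
    ∫ ω, w s ω ⬝ᵥ (N *ᵥ w t ω) ∂μ = if s = t then N.trace else 0 := by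
  have hint := fun i j => hw.integrable_const_mul_mul (N i j) s t i j
  calc ∫ ω, w s ω ⬝ᵥ (N *ᵥ w t ω) ∂μ = ∑ i, ∑ j, N i j * if s = t ∧ i = j then 1 else 0 := by
        simp only [dotProduct_mulVec_eq_sum_sum]
        rw [integral_finsetSum _ fun i _ => integrable_finsetSum _ fun j _ => hint i j]
        refine Finset.sum_congr rfl fun i _ => ?_
        rw [integral_finsetSum _ fun j _ => hint i j]
        simp only [integral_const_mul, hw.cov]
    _ = if s = t then N.trace else 0 := by
        by_cases hst : s = t <;> simp [hst, Matrix.trace]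

variable [Fintype α] [Fintype β] (W : Matrix α β ℝ) (F : ℕ → Matrix α ι ℝ) (G : ℕ → Matrix β ι ℝ)

theorem integrable_filterResponse_dotProduct_mulVec (hw : IsOrthonormalNoise μ w) (t : ℕ) :
    Integrable (fun ω => filterResponse F (fun s => w s ω) t
      ⬝ᵥ (W *ᵥ filterResponse G (fun s => w s ω) t)) μ := by
  simp only [filterResponse_dotProduct_mulVec]
  exact integrable_finsetSum _ fun i _ => integrable_finsetSum _ fun j _ =>
    hw.integrable_dotProduct_mulVec _ _ _

theorem integral_filterResponse_dotProduct_mulVec (hw : IsOrthonormalNoise μ w) (t : ℕ) :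
    ∫ ω, filterResponse F (fun s => w s ω) t ⬝ᵥ (W *ᵥ filterResponse G (fun s => w s ω) t) ∂μ
      = ∑ i ∈ Finset.range t, traceForm W (F i) (G i) := by
  simp only [filterResponse_dotProduct_mulVec]
  rw [integral_finsetSum _ fun i _ => integrable_finsetSum _ fun j _ =>
    hw.integrable_dotProduct_mulVec _ _ _]
  refine Finset.sum_congr rfl fun i hi => ?_
  rw [integral_finsetSum _ fun j _ => hw.integrable_dotProduct_mulVec _ _ _]
  simp only [hw.integral_dotProduct_mulVec]
  rw [Finset.sum_eq_single_of_mem i hi, if_pos rfl, traceForm]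
  intro j hj hji
  rw [Finset.mem_range] at hi hj
  exact if_neg (by omega)

end IsOrthonormalNoise

namespace LQRSystem

open Matrix MeasureTheory Filter Topology

variable {n m : ℕ} {sys : LQRSystem n m}

/-- The state responses `1, A + B U₀, …` to a unit impulse of the disturbance, when the input
responds by `U`. -/
def impulse (sys : LQRSystem n m) (U : ℕ → Matrix (Fin m) (Fin n) ℝ) : ℕ → Matrix (Fin n) (Fin n) ℝ
  | 0 => 1
  | i + 1 => sys.A * sys.impulse U i + sys.B * U i

/-- The input responses of a disturbance response controller to a unit impulse of the disturbance:
its coefficients, extended by `0` beyond its order. -/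
def drcImpulse {H : ℕ} (L : Fin H → Matrix (Fin m) (Fin n) ℝ) (i : ℕ) : Matrix (Fin m) (Fin n) ℝ :=
  if h : i < H then L ⟨i, h⟩ else 0

/-- The stage cost summed over matching columns of the responses `X` and `U`. -/
noncomputable def impulseCost (sys : LQRSystem n m) {ν : Type*} [Fintype ν]
    (X : Matrix (Fin n) ν ℝ) (U : Matrix (Fin m) ν ℝ) : ℝ :=
  traceForm sys.Q X X + traceForm sys.R U U + 2 * traceForm sys.S U X

/-- The closed-loop matrix `A + B K` of the state feedback `K`. -/
abbrev closedLoop (sys : LQRSystem n m) (K : Matrix (Fin m) (Fin n) ℝ) : Matrix (Fin n) (Fin n) ℝ :=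
  sys.A + sys.B * K

section Responses

theorem state_eq_filterResponse (U : ℕ → Matrix (Fin m) (Fin n) ℝ) (w : ℕ → Fin n → ℝ) (t : ℕ) :
    sys.state (filterResponse U w) w t = filterResponse (sys.impulse U) w t := by
  induction t with
  | zero => rfl
  | succ t ih =>
    rw [state, ih, filterResponse_succ, mulVec_filterResponse, mulVec_filterResponse,
      ← filterResponse_add, impulse, one_mulVec]
    rfl

theorem feedbackState_eq_filterResponse (K : Matrix (Fin m) (Fin n) ℝ) (w : ℕ → Fin n → ℝ)
    (t : ℕ) : sys.feedbackState K w t = filterResponse (fun i => sys.closedLoop K ^ i) w t := by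
  induction t with
  | zero => rfl
  | succ t ih =>
    rw [feedbackState, ih, filterResponse_succ, mulVec_mulVec, ← add_mulVec, mulVec_filterResponse,
      pow_zero, one_mulVec]
    simp only [pow_succ']

theorem drcInput_eq_filterResponse {H : ℕ} (L : Fin H → Matrix (Fin m) (Fin n) ℝ)
    (w : ℕ → Fin n → ℝ) : drcInput L w = filterResponse (drcImpulse L) w := by
  funext t
  calc drcInput L w t
      = ∑ i ∈ Finset.range H, if i < t then drcImpulse L i *ᵥ w (t - (i + 1)) else 0 := by
        rw [drcInput, Finset.sum_range]
        exact Finset.sum_congr rfl fun i _ => by simp [drcImpulse]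
    _ = ∑ i ∈ Finset.range t, if i < H then drcImpulse L i *ᵥ w (t - (i + 1)) else 0 := by
        rw [← Finset.sum_filter, ← Finset.sum_filter]
        exact Finset.sum_congr (by ext i; simp [and_comm]) fun _ _ => rfl
    _ = filterResponse (drcImpulse L) w t :=
        Finset.sum_congr rfl fun i _ => by by_cases hi : i < H <;> simp [hi, drcImpulse]

theorem drcImpulse_of_lt {H : ℕ} (L : Fin H → Matrix (Fin m) (Fin n) ℝ) {i : ℕ} (hi : i < H) :
    drcImpulse L i = L ⟨i, hi⟩ :=
  dif_pos hi

theorem drcImpulse_add {H : ℕ} (L : Fin H → Matrix (Fin m) (Fin n) ℝ) (k : ℕ) :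
    drcImpulse L (k + H) = 0 :=
  dif_neg (by omega)

theorem impulse_drcImpulse_add {H : ℕ} (L : Fin H → Matrix (Fin m) (Fin n) ℝ) (k : ℕ) :
    sys.impulse (drcImpulse L) (k + H) = sys.A ^ k * sys.impulse (drcImpulse L) H := by
  induction k with
  | zero => simp
  | succ k ih =>
    rw [Nat.succ_add, impulse, ih, drcImpulse_add, Matrix.mul_zero, add_zero, pow_succ',
      Matrix.mul_assoc]

theorem impulse_feedback (K : Matrix (Fin m) (Fin n) ℝ) (i : ℕ) :
    sys.impulse (fun i => K * sys.closedLoop K ^ i) i = sys.closedLoop K ^ i := by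
  induction i with
  | zero => rfl
  | succ i ih => rw [impulse, ih, pow_succ', Matrix.add_mul, Matrix.mul_assoc]

theorem impulse_congr {U V : ℕ → Matrix (Fin m) (Fin n) ℝ} {H : ℕ} (h : ∀ i < H, U i = V i) :
    ∀ i ≤ H, sys.impulse U i = sys.impulse V i
  | 0, _ => rfl
  | i + 1, hi => by rw [impulse, impulse, impulse_congr h i (by omega), h i hi]

end Responses

section AverageCost

variable {Ω : Type*} [MeasurableSpace Ω] {μ : Measure Ω} {w : ℕ → Ω → Fin n → ℝ}
  {F : ℕ → Matrix (Fin n) (Fin n) ℝ} {G : ℕ → Matrix (Fin m) (Fin n) ℝ} {c : ℝ}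

theorem integrable_stageCost (hw : IsOrthonormalNoise μ w) (t : ℕ) :
    Integrable (fun ω => sys.stageCost (filterResponse F (fun s => w s ω) t)
      (filterResponse G (fun s => w s ω) t)) μ :=
  ((hw.integrable_filterResponse_dotProduct_mulVec sys.Q F F t).add
    (hw.integrable_filterResponse_dotProduct_mulVec sys.R G G t)).add
    ((hw.integrable_filterResponse_dotProduct_mulVec sys.S G F t).const_mul 2)

theorem integral_stageCost (hw : IsOrthonormalNoise μ w) (t : ℕ) :
    ∫ ω, sys.stageCost (filterResponse F (fun s => w s ω) t)
      (filterResponse G (fun s => w s ω) t) ∂μ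
      = ∑ i ∈ Finset.range t, sys.impulseCost (F i) (G i) := by
  have hQ := hw.integrable_filterResponse_dotProduct_mulVec sys.Q F F t
  have hR := hw.integrable_filterResponse_dotProduct_mulVec sys.R G G t
  have hS := (hw.integrable_filterResponse_dotProduct_mulVec sys.S G F t).const_mul 2
  simp only [stageCost]
  rw [integral_add ?_ hS, integral_add hQ hR, integral_const_mul]
  · simp only [hw.integral_filterResponse_dotProduct_mulVec, impulseCost, Finset.sum_add_distrib,
      Finset.mul_sum]
  · exact hQ.add hR

theorem tendsto_average_stageCost (hw : IsOrthonormalNoise μ w)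
    (hc : HasSum (fun i => sys.impulseCost (F i) (G i)) c) :
    Tendsto (fun T : ℕ => (1 / (T : ℝ)) * ∫ ω, ∑ t ∈ Finset.range T,
      sys.stageCost (filterResponse F (fun s => w s ω) t)
        (filterResponse G (fun s => w s ω) t) ∂μ) atTop (𝓝 c) := by
  refine hc.tendsto_sum_nat.cesaro.congr fun T => ?_
  rw [integral_finsetSum _ fun t _ => integrable_stageCost hw t, one_div]
  simp only [integral_stageCost hw]

theorem tendsto_drcAvgCost (hw : IsOrthonormalNoise μ w) {H : ℕ}
    {L : Fin H → Matrix (Fin m) (Fin n) ℝ}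
    (hc : HasSum (fun i => sys.impulseCost (sys.impulse (drcImpulse L) i) (drcImpulse L i)) c) :
    Tendsto (sys.drcAvgCost μ w L) atTop (𝓝 c) := by
  refine (tendsto_average_stageCost hw hc).congr fun T => ?_
  simp only [drcAvgCost, drcInput_eq_filterResponse, state_eq_filterResponse]

theorem tendsto_feedbackAvgCost (hw : IsOrthonormalNoise μ w) {K : Matrix (Fin m) (Fin n) ℝ}
    (hc : HasSum (fun i => sys.impulseCost (sys.closedLoop K ^ i) (K * sys.closedLoop K ^ i)) c) :
    Tendsto (sys.feedbackAvgCost μ w K) atTop (𝓝 c) := by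
  refine (tendsto_average_stageCost hw hc).congr fun T => ?_
  simp only [feedbackAvgCost, feedbackState_eq_filterResponse, mulVec_filterResponse]

end AverageCost

/-- Half the Hessian `R + Bᵀ P B` in `u` of the one-step lookahead
`stageCost x u + (A x + B u)ᵀ P (A x + B u)`. -/
def inputHessian (sys : LQRSystem n m) (P : Matrix (Fin n) (Fin n) ℝ) : Matrix (Fin m) (Fin m) ℝ :=
  sys.R + sys.Bᵀ * P * sys.B

/-- A symmetric solution `P` of the Riccati equation together with its gain `K`, in the form that
completing the square uses, free of inverses. -/
structure IsRiccatiPair (sys : LQRSystem n m) (P : Matrix (Fin n) (Fin n) ℝ)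
    (K : Matrix (Fin m) (Fin n) ℝ) : Prop where
  transpose_eq : Pᵀ = P
  posDef : (sys.inputHessian P).PosDef
  gain_eq : sys.inputHessian P * K = -(sys.Bᵀ * P * sys.A + sys.S)
  stateWeight_eq : sys.Q = P - sys.Aᵀ * P * sys.A + Kᵀ * sys.inputHessian P * K

theorem posDef_inputWeight (hw : sys.weight.PosDef) : sys.R.PosDef :=
  hw.submatrix Sum.inr_injective

theorem IsCostToGo.isRiccatiPair {P : Matrix (Fin n) (Fin n) ℝ} (hP : sys.IsCostToGo P)
    (hR : sys.R.PosDef) : sys.IsRiccatiPair P (sys.gain P) := by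
  have hPt : Pᵀ = P := hP.1.isHermitian
  have hM : (sys.inputHessian P).PosDef :=
    hR.add_posSemidef (hP.1.conjTranspose_mul_mul_same sys.B)
  have hMt : (sys.inputHessian P)ᵀ = sys.inputHessian P := hM.isHermitian
  have hgain : sys.inputHessian P * sys.gain P = -(sys.Bᵀ * P * sys.A + sys.S) := by
    rw [gain, Matrix.mul_neg, ← inputHessian,
      mul_nonsing_inv_cancel_left _ _ ((isUnit_iff_isUnit_det _).1 hM.isUnit)]
  have hgain_transpose :
      (sys.gain P)ᵀ * sys.inputHessian P = -(sys.Aᵀ * P * sys.B + sys.Sᵀ) := by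
    rw [← hMt, ← transpose_mul, hgain]
    simp only [transpose_neg, transpose_add, transpose_mul, transpose_transpose, hPt,
      Matrix.mul_assoc]
  refine ⟨hPt, hM, hgain, ?_⟩
  rw [hgain_transpose, gain, Matrix.neg_mul, Matrix.mul_neg, neg_neg, ← Matrix.mul_assoc,
    ← sub_eq_iff_eq_add'.2 hP.2]
  abel

namespace IsRiccatiPair

variable {P : Matrix (Fin n) (Fin n) ℝ} {K : Matrix (Fin m) (Fin n) ℝ}

theorem inputHessian_transpose (h : sys.IsRiccatiPair P K) :
    (sys.inputHessian P)ᵀ = sys.inputHessian P :=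
  h.posDef.isHermitian

theorem stateWeight_transpose (h : sys.IsRiccatiPair P K) : sys.Qᵀ = sys.Q := by
  rw [h.stateWeight_eq]
  simp only [transpose_add, transpose_sub, transpose_mul, transpose_transpose, h.transpose_eq,
    h.inputHessian_transpose, Matrix.mul_assoc]

theorem impulseCost_eq (h : sys.IsRiccatiPair P K) {ν : Type*} [Fintype ν]
    (X : Matrix (Fin n) ν ℝ) (U : Matrix (Fin m) ν ℝ) :
    sys.impulseCost X U
      = traceForm P X X - traceForm P (sys.A * X + sys.B * U) (sys.A * X + sys.B * U)
        + traceForm (sys.inputHessian P) (U - K * X) (U - K * X) := by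
  have hR : sys.R = sys.inputHessian P - sys.Bᵀ * P * sys.B := by rw [inputHessian]; abel
  have hS : sys.S = -(sys.inputHessian P * K) - sys.Bᵀ * P * sys.A := by rw [h.gain_eq]; abel
  have hswapP : traceForm P (sys.A * X) (sys.B * U) = traceForm P (sys.B * U) (sys.A * X) := by
    rw [traceForm_comm, h.transpose_eq]
  have hswapM : traceForm (sys.inputHessian P) (K * X) U
      = traceForm (sys.inputHessian P) U (K * X) := by
    rw [traceForm_comm, h.inputHessian_transpose]
  rw [impulseCost, h.stateWeight_eq, hR, hS]
  simp only [traceForm, transpose_add, transpose_sub, transpose_mul, Matrix.mul_add,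
    Matrix.add_mul, Matrix.mul_sub, Matrix.sub_mul, Matrix.mul_neg, Matrix.neg_mul, trace_add,
    trace_sub, trace_neg, Matrix.mul_assoc] at hswapP hswapM ⊢
  linarith

theorem hasSum_deviation (h : sys.IsRiccatiPair P K) {U : ℕ → Matrix (Fin m) (Fin n) ℝ} {c : ℝ}
    (hc : HasSum (fun i => sys.impulseCost (sys.impulse U i) (U i)) c)
    (hP : Summable fun i => traceForm P (sys.impulse U i) (sys.impulse U i)) :
    HasSum (fun i => traceForm (sys.inputHessian P) (U i - K * sys.impulse U i)
      (U i - K * sys.impulse U i)) (c - P.trace) := by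
  have htrace : traceForm P (sys.impulse U 0) (sys.impulse U 0) = P.trace := by
    simp [traceForm, impulse]
  rw [← htrace]
  refine (hc.sub (hasSum_sub_succ hP)).congr_fun fun i => ?_
  rw [h.impulseCost_eq, ← impulse]
  ring

theorem trace_le_of_hasSum (h : sys.IsRiccatiPair P K) {U : ℕ → Matrix (Fin m) (Fin n) ℝ} {c : ℝ}
    (hc : HasSum (fun i => sys.impulseCost (sys.impulse U i) (U i)) c)
    (hP : Summable fun i => traceForm P (sys.impulse U i) (sys.impulse U i)) : P.trace ≤ c :=
  sub_nonneg.1 ((h.hasSum_deviation hc hP).nonneg fun _ =>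
    traceForm_self_nonneg h.posDef.posSemidef _)

theorem hasSum_feedback (h : sys.IsRiccatiPair P K) {τ r : ℝ}
    (hAK : IsTauStable τ r (sys.closedLoop K)) (hr : 0 ≤ r) (hr1 : r < 1) :
    HasSum (fun i => sys.impulseCost (sys.closedLoop K ^ i) (K * sys.closedLoop K ^ i))
      P.trace := by
  have hP : Summable fun i => traceForm P (sys.closedLoop K ^ i) (sys.closedLoop K ^ i) :=
    (hAK.hasSum_traceForm hr hr1 P (1 : Matrix (Fin n) (Fin n) ℝ)).summable.congr fun i => by
      rw [Matrix.mul_one]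
  have htrace : traceForm P (sys.closedLoop K ^ 0) (sys.closedLoop K ^ 0) = P.trace := by
    simp [traceForm]
  rw [← htrace]
  refine (hasSum_sub_succ hP).congr_fun fun i => ?_
  rw [h.impulseCost_eq, ← Matrix.mul_assoc, ← Matrix.add_mul, ← pow_succ', sub_self]
  simp [traceForm]

end IsRiccatiPair

/-- The limit cost of a disturbance response controller in closed form: after time `H` the state
response evolves by `A` alone. -/
noncomputable def drcLimitCost (sys : LQRSystem n m) {H : ℕ}
    (L : Fin H → Matrix (Fin m) (Fin n) ℝ) : ℝ :=
  traceForm (gramian sys.A sys.Q) (sys.impulse (drcImpulse L) H) (sys.impulse (drcImpulse L) H)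
    + ∑ i ∈ Finset.range H, sys.impulseCost (sys.impulse (drcImpulse L) i) (drcImpulse L i)

section DisturbanceResponse

variable {τ r : ℝ} {H : ℕ}

theorem hasSum_drcLimitCost (hA : IsTauStable τ r sys.A) (hr : 0 ≤ r) (hr1 : r < 1)
    (L : Fin H → Matrix (Fin m) (Fin n) ℝ) :
    HasSum (fun i => sys.impulseCost (sys.impulse (drcImpulse L) i) (drcImpulse L i))
      (sys.drcLimitCost L) := by
  rw [← hasSum_nat_add_iff' H, drcLimitCost, add_sub_cancel_right]
  refine (hA.hasSum_traceForm hr hr1 sys.Q (sys.impulse (drcImpulse L) H)).congr_fun fun k => ?_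
  rw [impulse_drcImpulse_add, drcImpulse_add]
  simp [impulseCost, traceForm]

theorem summable_traceForm_impulse (hA : IsTauStable τ r sys.A) (hr : 0 ≤ r) (hr1 : r < 1)
    (P : Matrix (Fin n) (Fin n) ℝ) (L : Fin H → Matrix (Fin m) (Fin n) ℝ) :
    Summable fun i =>
      traceForm P (sys.impulse (drcImpulse L) i) (sys.impulse (drcImpulse L) i) := by
  rw [← summable_nat_add_iff H]
  simp only [impulse_drcImpulse_add]
  exact (hA.hasSum_traceForm hr hr1 P _).summable

theorem continuous_drcImpulse (i : ℕ) :
    Continuous fun L : Fin H → Matrix (Fin m) (Fin n) ℝ => drcImpulse L i := by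
  by_cases h : i < H
  · simpa only [drcImpulse, h, dite_true] using continuous_apply _
  · simpa only [drcImpulse, h, dite_false] using continuous_const

theorem continuous_impulse (i : ℕ) :
    Continuous fun L : Fin H → Matrix (Fin m) (Fin n) ℝ => sys.impulse (drcImpulse L) i := by
  induction i with
  | zero => exact continuous_const
  | succ i ih =>
    exact (continuous_const.matrix_mul ih).add
      (continuous_const.matrix_mul (continuous_drcImpulse i))

theorem continuous_drcLimitCost :
    Continuous fun L : Fin H → Matrix (Fin m) (Fin n) ℝ => sys.drcLimitCost L :=
  (continuous_traceForm _ (continuous_impulse H) (continuous_impulse H)).add <|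
    continuous_finsetSum _ fun i _ =>
      ((continuous_traceForm _ (continuous_impulse i) (continuous_impulse i)).add
        (continuous_traceForm _ (continuous_drcImpulse i) (continuous_drcImpulse i))).add
        ((continuous_traceForm _ (continuous_drcImpulse i) (continuous_impulse i)).const_mul 2)

theorem exists_norm_impulse_le (sys : LQRSystem n m) (K : Matrix (Fin m) (Fin n) ℝ) (δ : ℝ)
    (i : ℕ) : ∃ b, ∀ U : ℕ → Matrix (Fin m) (Fin n) ℝ,
      (∀ j, ‖U j - K * sys.impulse U j‖ ≤ δ) → ‖sys.impulse U i‖ ≤ b := by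
  induction i with
  | zero => exact ⟨‖(1 : Matrix (Fin n) (Fin n) ℝ)‖, fun U _ => le_rfl⟩
  | succ i ih =>
    obtain ⟨b, hb⟩ := ih
    refine ⟨‖sys.closedLoop K‖ * b + ‖sys.B‖ * δ, fun U hU => ?_⟩
    have hstep : sys.impulse U (i + 1)
        = sys.closedLoop K * sys.impulse U i + sys.B * (U i - K * sys.impulse U i) := by
      rw [impulse, Matrix.add_mul, Matrix.mul_sub, Matrix.mul_assoc]
      abel
    rw [hstep]
    refine (norm_add_le _ _).trans (add_le_add ?_ ?_)
    · exact (norm_mul_le _ _).trans (by gcongr; exact hb U hU)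
    · exact (l2_opNorm_mul _ _).trans (by gcongr; exact hU i)

variable {P : Matrix (Fin n) (Fin n) ℝ} {K : Matrix (Fin m) (Fin n) ℝ}

theorem IsRiccatiPair.exists_norm_deviation_le (h : sys.IsRiccatiPair P K)
    (hA : IsTauStable τ r sys.A) (hr : 0 ≤ r) (hr1 : r < 1) (c : ℝ) :
    ∃ δ, ∀ L : Fin H → Matrix (Fin m) (Fin n) ℝ, sys.drcLimitCost L ≤ c →
      ∀ i, ‖drcImpulse L i - K * sys.impulse (drcImpulse L) i‖ ≤ δ := by
  obtain ⟨ε, hε, hbound⟩ := exists_pos_mul_norm_sq_le_traceForm (ν := Fin n) h.posDef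
  refine ⟨√((c - P.trace) / ε), fun L hL i => Real.le_sqrt_of_sq_le ?_⟩
  have hterm := le_hasSum (h.hasSum_deviation (hasSum_drcLimitCost hA hr hr1 L)
    (summable_traceForm_impulse hA hr hr1 P L)) i fun j _ =>
    traceForm_self_nonneg h.posDef.posSemidef _
  rw [le_div_iff₀' hε]
  linarith [hbound (drcImpulse L i - K * sys.impulse (drcImpulse L) i)]

theorem IsRiccatiPair.isBounded_setOf_drcLimitCost_le (h : sys.IsRiccatiPair P K)
    (hA : IsTauStable τ r sys.A) (hr : 0 ≤ r) (hr1 : r < 1) (c : ℝ) :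
    Bornology.IsBounded {L : Fin H → Matrix (Fin m) (Fin n) ℝ | sys.drcLimitCost L ≤ c} := by
  obtain ⟨δ, hδ⟩ := h.exists_norm_deviation_le (H := H) hA hr hr1 c
  refine Bornology.forall_isBounded_image_eval_iff.1 fun i => ?_
  obtain ⟨b, hb⟩ := exists_norm_impulse_le sys K δ i
  refine isBounded_iff_forall_norm_le.2 ⟨δ + ‖K‖ * b, ?_⟩
  rintro _ ⟨L, hL, rfl⟩
  have himpulse := hb _ (hδ L hL)
  calc ‖L i‖ = ‖(drcImpulse L i - K * sys.impulse (drcImpulse L) i)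
        + K * sys.impulse (drcImpulse L) i‖ := by rw [sub_add_cancel, drcImpulse_of_lt L i.2]
    _ ≤ δ + ‖K‖ * b :=
      (norm_add_le _ _).trans
        (add_le_add (hδ L hL i) ((l2_opNorm_mul _ _).trans (by gcongr)))

theorem IsRiccatiPair.exists_forall_drcLimitCost_le (h : sys.IsRiccatiPair P K)
    (hA : IsTauStable τ r sys.A) (hr : 0 ≤ r) (hr1 : r < 1) (H : ℕ) :
    ∃ L : Fin H → Matrix (Fin m) (Fin n) ℝ,
      ∀ L' : Fin H → Matrix (Fin m) (Fin n) ℝ, sys.drcLimitCost L ≤ sys.drcLimitCost L' :=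
  continuous_drcLimitCost.exists_forall_le_of_isBounded 0
    (h.isBounded_setOf_drcLimitCost_le hA hr hr1 _)

end DisturbanceResponse

/-- The disturbance response controller of order `H` that agrees with the feedback `K` on the first
`H` input responses. -/
def truncatedFeedback (sys : LQRSystem n m) (K : Matrix (Fin m) (Fin n) ℝ) (H : ℕ) :
    Fin H → Matrix (Fin m) (Fin n) ℝ :=
  fun h => K * sys.closedLoop K ^ (h : ℕ)

section Truncation

variable {τ r : ℝ} {K : Matrix (Fin m) (Fin n) ℝ}

theorem drcImpulse_truncatedFeedback {H i : ℕ} (hi : i < H) :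
    drcImpulse (sys.truncatedFeedback K H) i = K * sys.closedLoop K ^ i :=
  drcImpulse_of_lt _ hi

theorem impulse_truncatedFeedback {H i : ℕ} (hi : i ≤ H) :
    sys.impulse (drcImpulse (sys.truncatedFeedback K H)) i = sys.closedLoop K ^ i := by
  rw [impulse_congr (fun _ => drcImpulse_truncatedFeedback) i hi, impulse_feedback]

theorem impulseCost_zero_sub_le (hQ : sys.Qᵀ = sys.Q) (hR : sys.R.PosSemidef) {ν : Type*}
    [Fintype ν] [DecidableEq ν] (X Y : Matrix (Fin n) ν ℝ) (U : Matrix (Fin m) ν ℝ) :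
    sys.impulseCost X 0 - sys.impulseCost Y U
      ≤ Fintype.card ν * (‖X - Y‖ * ‖sys.Q‖ * ‖X + Y‖)
        + 2 * (Fintype.card ν * (‖U‖ * ‖sys.S‖ * ‖Y‖)) := by
  have hpolar : traceForm sys.Q (X - Y) (X + Y) = traceForm sys.Q X X - traceForm sys.Q Y Y := by
    have hswap : traceForm sys.Q Y X = traceForm sys.Q X Y := by rw [traceForm_comm, hQ]
    simp only [traceForm, transpose_sub, Matrix.sub_mul, Matrix.mul_add, trace_sub,
      trace_add] at hswap ⊢
    linarith
  have hX : sys.impulseCost X 0 = traceForm sys.Q X X := by simp [impulseCost, traceForm]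
  have hneg : traceForm sys.S (-U) Y = -traceForm sys.S U Y := by simp [traceForm]
  have hstate := traceForm_le sys.Q (X - Y) (X + Y)
  have hcross := traceForm_le sys.S (-U) Y
  rw [hpolar] at hstate
  rw [hneg, norm_neg] at hcross
  rw [hX, impulseCost]
  linarith [traceForm_self_nonneg hR U]

theorem norm_pow_mul_pow_sub_pow_add_le (hA : IsTauStable τ r sys.A)
    (hAK : IsTauStable τ r (sys.closedLoop K)) (hr : 0 < r) (H k : ℕ) :
    ‖sys.A ^ k * sys.closedLoop K ^ H - sys.closedLoop K ^ (k + H)‖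
      ≤ k * (τ ^ 2 * (‖sys.B‖ * ‖K‖) * r ^ (k + H)) / r := by
  have hBK : ‖sys.A - sys.closedLoop K‖ ≤ ‖sys.B‖ * ‖K‖ := by
    rw [closedLoop, sub_add_cancel_left, norm_neg]
    exact l2_opNorm_mul _ _
  rw [pow_add, ← sub_mul, le_div_iff₀' hr]
  exact (hA.norm_pow_sub_pow_mul_pow_le hAK hr.le k H).trans (by gcongr)

theorem impulseCost_truncatedFeedback_sub_le (hQ : sys.Qᵀ = sys.Q) (hR : sys.R.PosSemidef)
    (hA : IsTauStable τ r sys.A) (hAK : IsTauStable τ r (sys.closedLoop K)) (hr : 0 < r)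
    (H k : ℕ) :
    sys.impulseCost (sys.A ^ k * sys.closedLoop K ^ H) 0
        - sys.impulseCost (sys.closedLoop K ^ (k + H)) (K * sys.closedLoop K ^ (k + H))
      ≤ 2 * n * τ ^ 4 * (r ^ 2) ^ H * ‖K‖ *
        (‖sys.B‖ * ‖sys.Q‖ / r * (k * (r ^ 2) ^ k) + ‖sys.S‖ * (r ^ 2) ^ k) := by
  set X := sys.A ^ k * sys.closedLoop K ^ H
  set Y := sys.closedLoop K ^ (k + H) with hYdef
  have hX : ‖X‖ ≤ τ ^ 2 * r ^ (k + H) := hA.norm_pow_mul_pow_le hAK hr.le k H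
  have hY : ‖Y‖ ≤ τ ^ 2 * r ^ (k + H) := by
    rw [hYdef, pow_add]
    exact hAK.norm_pow_mul_pow_le hAK hr.le k H
  have hsub : ‖X - Y‖ ≤ k * (τ ^ 2 * (‖sys.B‖ * ‖K‖) * r ^ (k + H)) / r :=
    norm_pow_mul_pow_sub_pow_add_le hA hAK hr H k
  have hadd : ‖X + Y‖ ≤ 2 * τ ^ 2 * r ^ (k + H) := (norm_add_le X Y).trans (by linarith)
  have hKY : ‖K * Y‖ ≤ ‖K‖ * (τ ^ 2 * r ^ (k + H)) := (l2_opNorm_mul K Y).trans (by gcongr)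
  calc sys.impulseCost X 0 - sys.impulseCost Y (K * Y)
      ≤ n * (‖X - Y‖ * ‖sys.Q‖ * ‖X + Y‖) + 2 * (n * (‖K * Y‖ * ‖sys.S‖ * ‖Y‖)) := by
        simpa only [Fintype.card_fin] using impulseCost_zero_sub_le hQ hR X Y (K * Y)
    _ ≤ n * (k * (τ ^ 2 * (‖sys.B‖ * ‖K‖) * r ^ (k + H)) / r * ‖sys.Q‖
          * (2 * τ ^ 2 * r ^ (k + H)))
        + 2 * (n * (‖K‖ * (τ ^ 2 * r ^ (k + H)) * ‖sys.S‖ * (τ ^ 2 * r ^ (k + H)))) := by gcongr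
    _ = 2 * n * τ ^ 4 * (r ^ 2) ^ H * ‖K‖ *
        (‖sys.B‖ * ‖sys.Q‖ / r * (k * (r ^ 2) ^ k) + ‖sys.S‖ * (r ^ 2) ^ k) := by ring

theorem drcLimitCost_truncatedFeedback_sub_le (hQ : sys.Qᵀ = sys.Q) (hR : sys.R.PosSemidef)
    (hA : IsTauStable τ r sys.A) (hAK : IsTauStable τ r (sys.closedLoop K)) (hr : 0 < r)
    (hr1 : r < 1) {c : ℝ}
    (hc : HasSum (fun i => sys.impulseCost (sys.closedLoop K ^ i) (K * sys.closedLoop K ^ i)) c)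
    (H : ℕ) :
    sys.drcLimitCost (sys.truncatedFeedback K H) - c
      ≤ 2 * n * τ ^ 4 * (r ^ 2) ^ H * ‖K‖ *
        (‖sys.B‖ * ‖sys.Q‖ / r * (r ^ 2 / (1 - r ^ 2) ^ 2) + ‖sys.S‖ * (1 - r ^ 2)⁻¹) := by
  set L := sys.truncatedFeedback K H
  set C := sys.closedLoop K
  have hhead : ∑ i ∈ Finset.range H, (sys.impulseCost (sys.impulse (drcImpulse L) i)
      (drcImpulse L i) - sys.impulseCost (C ^ i) (K * C ^ i)) = 0 :=
    Finset.sum_eq_zero fun i hi => by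
      have hi : i < H := Finset.mem_range.1 hi
      rw [drcImpulse_truncatedFeedback hi, impulse_truncatedFeedback hi.le, sub_self]
  have htail := (hasSum_nat_add_iff' H).2 ((hasSum_drcLimitCost hA hr.le hr1 L).sub hc)
  rw [hhead, sub_zero] at htail
  have hr2 : ‖r ^ 2‖ < 1 := by
    rw [Real.norm_of_nonneg (by positivity)]
    exact pow_lt_one₀ hr.le hr1 two_ne_zero
  have hgeom := (((hasSum_coe_mul_geometric_of_norm_lt_one hr2).mul_left
    (‖sys.B‖ * ‖sys.Q‖ / r)).add ((hasSum_geometric_of_norm_lt_one hr2).mul_left ‖sys.S‖)).mul_left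
      (2 * n * τ ^ 4 * (r ^ 2) ^ H * ‖K‖)
  refine hasSum_le (fun k => ?_) htail hgeom
  rw [impulse_drcImpulse_add, drcImpulse_add, impulse_truncatedFeedback le_rfl]
  exact impulseCost_truncatedFeedback_sub_le hQ hR hA hAK hr H k

theorem truncation_bound_le {n : ℕ} {τ r R S B Q K E : ℝ} (hr : 0 < r) (hr1 : r < 1)
    (hR : 0 ≤ R) (hS : 0 ≤ S) (hB : 0 ≤ B) (hQ : 0 ≤ Q) (hK : 0 ≤ K) (hE : 0 ≤ E) :
    2 * n * τ ^ 4 * E * K * (B * Q / r * (r ^ 2 / (1 - r ^ 2) ^ 2) + S * (1 - r ^ 2)⁻¹)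
      ≤ (n : ℝ) ^ 2 * E * (R + 4 * τ ^ 4 * (B * K ^ 2 + K) * (B * Q + S) / (1 - r ^ 2) ^ 3) := by
  have hD : 0 < 1 - r ^ 2 := sub_pos.2 (pow_lt_one₀ hr.le hr1 two_ne_zero)
  have hD1 : 1 - r ^ 2 ≤ 1 := sub_le_self 1 (sq_nonneg r)
  have hn : (n : ℝ) ≤ (n : ℝ) ^ 2 := by exact_mod_cast Nat.le_self_pow two_ne_zero n
  set D := 1 - r ^ 2
  have hstate : B * Q / r * (r ^ 2 / D ^ 2) ≤ B * Q / D ^ 3 :=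
    calc B * Q / r * (r ^ 2 / D ^ 2) = r * D * (B * Q / D ^ 3) := by field_simp
      _ ≤ B * Q / D ^ 3 :=
        mul_le_of_le_one_left (by positivity) (mul_le_one₀ hr1.le hD.le hD1)
  have hcross : S * D⁻¹ ≤ S / D ^ 3 :=
    calc S * D⁻¹ = D ^ 2 * (S / D ^ 3) := by field_simp
      _ ≤ S / D ^ 3 := mul_le_of_le_one_left (by positivity) (pow_le_one₀ hD.le hD1)
  have hgain : 2 * K ≤ 4 * (B * K ^ 2 + K) := by linarith [mul_nonneg hB (sq_nonneg K)]
  calc 2 * n * τ ^ 4 * E * K * (B * Q / r * (r ^ 2 / D ^ 2) + S * D⁻¹)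
      ≤ 2 * (n : ℝ) ^ 2 * τ ^ 4 * E * K * (B * Q / D ^ 3 + S / D ^ 3) := by gcongr
    _ = (n : ℝ) ^ 2 * E * (τ ^ 4 * (2 * K) * (B * Q + S) / D ^ 3) := by ring
    _ ≤ (n : ℝ) ^ 2 * E * (τ ^ 4 * (4 * (B * K ^ 2 + K)) * (B * Q + S) / D ^ 3) := by gcongr
    _ = (n : ℝ) ^ 2 * E * (4 * τ ^ 4 * (B * K ^ 2 + K) * (B * Q + S) / D ^ 3) := by ring
    _ ≤ (n : ℝ) ^ 2 * E * (R + 4 * τ ^ 4 * (B * K ^ 2 + K) * (B * Q + S) / D ^ 3) := by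
        gcongr
        exact le_add_of_nonneg_left hR

end Truncation

end LQRSystem

open LQRSystem

theorem mainTheorem2_general {n m : ℕ} (sys : LQRSystem n m)
    {Ω : Type*} [MeasurableSpace Ω] (μ : MeasureTheory.Measure Ω)
    (w : ℕ → Ω → Fin n → ℝ) (hw : IsOrthonormalNoise μ w) (hR : sys.R.PosSemidef)
    (P : Matrix (Fin n) (Fin n) ℝ) (K : Matrix (Fin m) (Fin n) ℝ) (hPK : sys.IsRiccatiPair P K)
    (τ ρ : ℝ) (hρ : 0 < ρ)
    (hA : IsTauStable τ (Real.exp (-ρ)) sys.A)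
    (hAK : IsTauStable τ (Real.exp (-ρ)) (sys.A + sys.B * K)) :
    Filter.Tendsto (sys.feedbackAvgCost μ w K) Filter.atTop (nhds (sys.feedbackCost μ w K)) ∧
    ∀ H : ℕ,
      (∀ L : Fin H → Matrix (Fin m) (Fin n) ℝ,
        Filter.Tendsto (sys.drcAvgCost μ w L) Filter.atTop (nhds (sys.drcCost μ w L))) ∧
      (∃ L : Fin H → Matrix (Fin m) (Fin n) ℝ, sys.IsOptimalDRC μ w L) ∧
      ∀ L : Fin H → Matrix (Fin m) (Fin n) ℝ, sys.IsOptimalDRC μ w L →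
        0 ≤ sys.drcCost μ w L - sys.feedbackCost μ w K ∧
        sys.drcCost μ w L - sys.feedbackCost μ w K ≤
          (n : ℝ) ^ 2 * Real.exp (-2 * ρ * H) *
            (‖sys.R‖ + 4 * τ ^ 4 * (‖sys.B‖ * ‖K‖ ^ 2 + ‖K‖) * (‖sys.B‖ * ‖sys.Q‖ + ‖sys.S‖)
              / (1 - Real.exp (-2 * ρ)) ^ 3) := by
  have hr : 0 < Real.exp (-ρ) := Real.exp_pos _
  have hr1 : Real.exp (-ρ) < 1 := Real.exp_lt_one_iff.2 (neg_neg_of_pos hρ)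
  have hsum := hPK.hasSum_feedback hAK hr.le hr1
  have hfb := tendsto_feedbackAvgCost hw hsum
  have hK : sys.feedbackCost μ w K = P.trace := hfb.limUnder_eq
  refine ⟨hK ▸ hfb, fun H => ?_⟩
  have hdrc (L : Fin H → Matrix (Fin m) (Fin n) ℝ) :=
    tendsto_drcAvgCost hw (hasSum_drcLimitCost hA hr.le hr1 L)
  have hL (L : Fin H → Matrix (Fin m) (Fin n) ℝ) : sys.drcCost μ w L = sys.drcLimitCost L :=
    (hdrc L).limUnder_eq
  have hexp : Real.exp (-2 * ρ) = Real.exp (-ρ) ^ 2 := by rw [← Real.exp_nat_mul]; ring_nf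
  have hexpH : Real.exp (-2 * ρ * H) = (Real.exp (-ρ) ^ 2) ^ H := by
    rw [← hexp, ← Real.exp_nat_mul, mul_comm]
  simp only [IsOptimalDRC, hK, hL, hexp, hexpH, sub_nonneg]
  refine ⟨fun L => hdrc L, hPK.exists_forall_drcLimitCost_le hA hr.le hr1 H, fun L hopt => ⟨?_, ?_⟩⟩
  · exact hPK.trace_le_of_hasSum (hasSum_drcLimitCost hA hr.le hr1 L)
      (summable_traceForm_impulse hA hr.le hr1 P L)
  · calc sys.drcLimitCost L - P.trace
        ≤ sys.drcLimitCost (sys.truncatedFeedback K H) - P.trace := sub_le_sub_right (hopt _) _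
      _ ≤ _ := drcLimitCost_truncatedFeedback_sub_le hPK.stateWeight_transpose hR hA hAK hr hr1
          hsum H
      _ ≤ _ := truncation_bound_le hr hr1 (norm_nonneg _) (norm_nonneg _) (norm_nonneg _)
          (norm_nonneg _) (norm_nonneg _) (by positivity)

theorem mainTheorem2 {n m : ℕ} (sys : LQRSystem n m)
    {Ω : Type*} [MeasurableSpace Ω] (μ : MeasureTheory.Measure Ω)
    [MeasureTheory.IsProbabilityMeasure μ] (w : ℕ → Ω → Fin n → ℝ) (hw : IsStandardNoise μ w)
    (hweight : sys.weight.PosDef)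
    (P : Matrix (Fin n) (Fin n) ℝ) (hP : sys.IsCostToGo P)
    (K : Matrix (Fin m) (Fin n) ℝ) (hK : K = sys.gain P)
    (τ ρ : ℝ) (hρ : 0 < ρ)
    (hA : IsTauStable τ (Real.exp (-ρ)) sys.A)
    (hAK : IsTauStable τ (Real.exp (-ρ)) (sys.A + sys.B * K)) :
    Filter.Tendsto (sys.feedbackAvgCost μ w K) Filter.atTop (nhds (sys.feedbackCost μ w K)) ∧
    ∀ H : ℕ,
      (∀ L : Fin H → Matrix (Fin m) (Fin n) ℝ,
        Filter.Tendsto (sys.drcAvgCost μ w L) Filter.atTop (nhds (sys.drcCost μ w L))) ∧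
      (∃ L : Fin H → Matrix (Fin m) (Fin n) ℝ, sys.IsOptimalDRC μ w L) ∧
      ∀ L : Fin H → Matrix (Fin m) (Fin n) ℝ, sys.IsOptimalDRC μ w L →
        0 ≤ sys.drcCost μ w L - sys.feedbackCost μ w K ∧
        sys.drcCost μ w L - sys.feedbackCost μ w K ≤
          (n : ℝ) ^ 2 * Real.exp (-2 * ρ * H) *
            (‖sys.R‖ + 4 * τ ^ 4 * (‖sys.B‖ * ‖K‖ ^ 2 + ‖K‖) * (‖sys.B‖ * ‖sys.Q‖ + ‖sys.S‖)
              / (1 - Real.exp (-2 * ρ)) ^ 3) := by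
  subst hK
  have hR := posDef_inputWeight hweight
  exact mainTheorem2_general sys μ w hw.isOrthonormalNoise hR.posSemidef P _
    (hP.isRiccatiPair hR) τ ρ hρ hA hAK
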